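/- Let $\mathcal A[\mathbb R^2]$ be the Weyl $C^*$-algebra, i.e. the (nonzero) unital $C^*$-algebra generated by two one-parameter groups of unitaries $\{U_a\}_{a\in\mathbb R}$, $\{V_b\}_{b\in\mathbb R}$ (so $U_{a+a'}=U_aU_{a'}$, $V_{b+b'}=V_bV_{b'}$, with no continuity assumed) satisfying the Weyl form of the canonical commutation relations $U_aV_b=e^{-iab}V_bU_a$ for all $a,b\in\mathbb R$; it is unique up to isomorphism. Let $b\mathbb R$ be the Bohr compactification of $\mathbb R$, i.e. the space of characters (pure states), with the weak* topology, of the $C^*$-algebra $AP(\mathbb R)$ of bounded continuous functions on $\mathbb R$ generated by the functions $u_a(x)=e^{iax}$, $a\in\mathbb R$. Regard $u_a$ as a continuous function on $b\mathbb R$ and $\mathbb R$ as a subset of $b\mathbb R$ via point evaluations. Let $(\pi,\mathcal H)$ be an irreducible representation of $\mathcal A[\mathbb R^2]$ on a Hilbert space, and let $(E^Q,E^P)$ be the corresponding pair of projection-valued measures on the Borel sets of $b\mathbb R$, i.e. $$\pi(U_a)=\int_{b\mathbb R}u_a(\lambda)\,dE^Q_\lambda,\qquad \pi(V_b)=\int_{b\mathbb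 R}u_b(\lambda)\,dE^P_\lambda\qquad(a,b\in\mathbb R),$$ where the left formula means $\langle\varphi,\pi(U_a)\varphi\rangle=\int_{b\mathbb R}u_a\,d\mu_\varphi$ with $\mu_\varphi(S)=\langle\varphi,E^Q(S)\varphi\rangle$ for every $\varphi\in\mathcal H$, and similarly for the right one. If $E^Q(\{\lambda\})\neq 0$ for some $\lambda\in\mathbb R$, then $E^P(\mathbb R)=0$. If $E^P(\{\lambda\})\neq 0$ for some $\lambda\in\mathbb R$, then $E^Q(\mathbb R)=0$. -/

import Mathlib

open MeasureTheory Filter Topology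
open scoped BoundedContinuousFunction InnerProductSpace

/-! ### The Bohr compactification of the real line -/

/-- The bounded continuous function `x ↦ e^{iax}` on `ℝ`. -/
noncomputable def bcExp (a : ℝ) : ℝ →ᵇ ℂ :=
  BoundedContinuousFunction.ofNormedAddCommGroup
    (fun x : ℝ => Complex.exp (((a * x : ℝ) : ℂ) * Complex.I)) (by fun_prop) 1
    (fun x => by rw [Complex.norm_exp_ofReal_mul_I])

/-- The C*-algebra `AP(ℝ)` of almost periodic functions: the C*-subalgebra of the bounded
continuous functions on `ℝ` generated by the exponentials `x ↦ e^{iax}`, `a ∈ ℝ`. -/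
noncomputable def almostPeriodic : StarSubalgebra ℂ (ℝ →ᵇ ℂ) :=
  (StarAlgebra.adjoin ℂ (Set.range bcExp)).topologicalClosure

/-- The exponential `u_a`, as an element of `AP(ℝ)`. -/
noncomputable def apExp (a : ℝ) : almostPeriodic :=
  ⟨bcExp a, StarSubalgebra.le_topologicalClosure _
    (StarAlgebra.subset_adjoin ℂ _ (Set.mem_range_self a))⟩

/-- The Bohr compactification `bℝ`: the space of characters (that is, of pure states) of the
commutative C*-algebra `AP(ℝ)`, with the weak-* topology. -/
abbrev BohrR : Type := WeakDual.characterSpace ℂ almostPeriodic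

noncomputable instance : MeasurableSpace BohrR := borel BohrR

instance : BorelSpace BohrR := ⟨rfl⟩

/-- The canonical map `ℝ → bℝ`, which sends `x` to the evaluation `f ↦ f x` on `AP(ℝ)`. -/
noncomputable def toBohr (x : ℝ) : BohrR :=
  ⟨(BoundedContinuousFunction.evalCLM ℂ x : (ℝ →ᵇ ℂ) →L[ℂ] ℂ).comp
      (Submodule.subtypeL (Subalgebra.toSubmodule almostPeriodic.toSubalgebra)), by
    rw [WeakDual.CharacterSpace.eq_set_map_one_map_mul]
    exact ⟨rfl, fun _ _ => rfl⟩⟩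

/-- The exponential `u_a` as a continuous function on `bℝ`, that is, its Gelfand transform. -/
noncomputable def bohrChar (a : ℝ) (χ : BohrR) : ℂ := χ (apExp a)

theorem toBohr_apply (x : ℝ) (f : almostPeriodic) : toBohr x f = (f : ℝ →ᵇ ℂ) x := rfl

theorem bohrChar_toBohr (a x : ℝ) :
    bohrChar a (toBohr x) = Complex.exp (((a * x : ℝ) : ℂ) * Complex.I) := rfl

theorem continuous_toBohr : Continuous toBohr := by
  refine continuous_induced_rng.mpr (WeakDual.continuous_of_continuous_eval fun f => ?_)
  exact (f : ℝ →ᵇ ℂ).continuous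

/-- The copy of `ℝ` in `bℝ` is a Borel set (it is σ-compact). -/
theorem measurableSet_range_toBohr : MeasurableSet (Set.range toBohr) := by
  have h : Set.range toBohr = ⋃ n : ℕ, toBohr '' Set.Icc (-(n : ℝ)) n := by
    ext χ
    simp only [Set.mem_range, Set.mem_iUnion, Set.mem_image, Set.mem_Icc]
    constructor
    · rintro ⟨x, rfl⟩
      obtain ⟨n, hn⟩ := exists_nat_ge |x|
      exact ⟨n, x, abs_le.mp hn, rfl⟩
    · rintro ⟨_, x, _, rfl⟩
      exact ⟨x, rfl⟩
  rw [h]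
  exact MeasurableSet.iUnion fun n =>
    (isCompact_Icc.image continuous_toBohr).isClosed.measurableSet

/-! ### Projection-valued measures -/

/-- A projection-valued measure on a measurable space `X`, acting on a Hilbert space `H`: a map
from measurable sets to orthogonal projections which is normalized, multiplicative on
intersections, and countably additive in the strong operator topology. The values on
non-measurable sets are irrelevant. -/
structure ProjectionValuedMeasure (X : Type*) [MeasurableSpace X]
    (H : Type*) [NormedAddCommGroup H] [InnerProductSpace ℂ H] [CompleteSpace H] where
  /-- The projection attached to a set. -/
  proj : Set X → H →L[ℂ] H
  isStarProjection : ∀ S, MeasurableSet S → IsStarProjection (proj S)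
  proj_univ : proj Set.univ = 1
  proj_inter : ∀ S T, MeasurableSet S → MeasurableSet T → proj (S ∩ T) = proj S * proj T
  hasSum_proj : ∀ S : ℕ → Set X, (∀ n, MeasurableSet (S n)) →
    Pairwise (Function.onFun Disjoint S) →
      ∀ φ : H, HasSum (fun n => proj (S n) φ) (proj (⋃ n, S n) φ)

namespace ProjectionValuedMeasure

variable {X : Type*} [MeasurableSpace X]
  {H : Type*} [NormedAddCommGroup H] [InnerProductSpace ℂ H] [CompleteSpace H]

theorem proj_empty_apply (E : ProjectionValuedMeasure X H) (φ : H) : E.proj ∅ φ = 0 := by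
  have h := E.hasSum_proj (fun _ => ∅) (fun _ => MeasurableSet.empty)
    (fun _ _ _ => disjoint_bot_left) φ
  exact tendsto_nhds_unique tendsto_const_nhds h.summable.tendsto_atTop_zero

theorem inner_proj_nonneg (E : ProjectionValuedMeasure X H) (φ : H) {S : Set X}
    (hS : MeasurableSet S) : 0 ≤ (⟪φ, E.proj S φ⟫_ℂ).re := by
  have h := E.isStarProjection S hS
  have h1 : E.proj S φ = E.proj S (E.proj S φ) :=
    (congrArg (fun T : H →L[ℂ] H => T φ) h.isIdempotentElem.eq).symm
  have h2 : ContinuousLinearMap.adjoint (E.proj S) = E.proj S := h.isSelfAdjoint.star_eq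
  have h3 : ⟪φ, E.proj S φ⟫_ℂ = ⟪E.proj S φ, E.proj S φ⟫_ℂ := by
    conv_lhs => rw [h1]
    rw [← ContinuousLinearMap.adjoint_inner_left, h2]
  rw [h3]
  exact inner_self_nonneg (𝕜 := ℂ)

/-- The measure `μ_φ(S) = ⟨φ, E(S) φ⟩` attached to a projection-valued measure `E` and a
vector `φ`. -/
noncomputable def vectorMeasure (E : ProjectionValuedMeasure X H) (φ : H) : Measure X :=
  Measure.ofMeasurable (fun S _ => ENNReal.ofReal (⟪φ, E.proj S φ⟫_ℂ).re)
    (by simp [proj_empty_apply])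
    (by
      intro S hS hd
      have h := (E.hasSum_proj S hS hd φ).mapL (innerSL ℂ φ)
      have h' := h.mapL Complex.reCLM
      simp only [innerSL_apply_apply, Complex.reCLM_apply] at h'
      rw [← h'.tsum_eq]
      exact ENNReal.ofReal_tsum_of_nonneg (fun n => E.inner_proj_nonneg φ (hS n)) h'.summable)

theorem vectorMeasure_apply (E : ProjectionValuedMeasure X H) (φ : H) {S : Set X}
    (hS : MeasurableSet S) :
    E.vectorMeasure φ S = ENNReal.ofReal (⟪φ, E.proj S φ⟫_ℂ).re :=
  Measure.ofMeasurable_apply S hS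

end ProjectionValuedMeasure

/-- `W a = ∫_{bℝ} u_a dE` for all `a ∈ ℝ`, in the weak sense:
`⟨φ, W a φ⟩ = ∫_{bℝ} u_a dμ_φ` for all vectors `φ`, where `μ_φ(S) = ⟨φ, E(S) φ⟩`. -/
def IsSpectralMeasureOf {H : Type*} [NormedAddCommGroup H] [InnerProductSpace ℂ H]
    [CompleteSpace H] (E : ProjectionValuedMeasure BohrR H) (W : ℝ → H →L[ℂ] H) : Prop :=
  ∀ (a : ℝ) (φ : H), ⟪φ, W a φ⟫_ℂ = ∫ χ, bohrChar a χ ∂(E.vectorMeasure φ)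

/-! ### The Weyl algebra and its irreducible representations -/

/-- `A`, with the families `U` and `V`, is the Weyl C*-algebra `𝒜[ℝ²]`: it is nonzero, `U` and `V`
are one-parameter groups of unitaries which obey the Weyl form of the canonical commutation
relations, and no proper C*-subalgebra of `A` contains all of them. -/
structure IsWeylAlgebra {A : Type*} [CStarAlgebra A] (U V : ℝ → A) : Prop where
  nontrivial : Nontrivial A
  unitary_U : ∀ a, U a ∈ unitary A
  unitary_V : ∀ b, V b ∈ unitary A
  add_U : ∀ a b, U (a + b) = U a * U b
  add_V : ∀ a b, V (a + b) = V a * V b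
  weyl : ∀ a b : ℝ, U a * V b = Complex.exp (-((a * b : ℝ) : ℂ) * Complex.I) • (V b * U a)
  generates : (StarAlgebra.adjoin ℂ (Set.range U ∪ Set.range V)).topologicalClosure = ⊤

/-- A representation of a C*-algebra on a Hilbert space `H` is irreducible if `H ≠ 0` and the only
closed invariant subspaces are `0` and `H`. -/
def IsIrreducibleRep {A : Type*} [CStarAlgebra A] {H : Type*} [NormedAddCommGroup H]
    [InnerProductSpace ℂ H] [CompleteSpace H] (π : A →⋆ₐ[ℂ] (H →L[ℂ] H)) : Prop :=
  Nontrivial H ∧ ∀ K : Submodule ℂ H, IsClosed (K : Set H) →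
    (∀ x : A, ∀ φ ∈ K, π x φ ∈ K) → K = ⊥ ∨ K = ⊤

/-! ### Existence of the Weyl algebra: the C*-algebra generated by the position representation -/

/-- The weighted shift `(W f)(x) = c(x) f(x + t)` on `ℓ²(ℝ)`, for `|c| = 1`. -/
noncomputable def weightedShift (c : ℝ → ℂ) (hc : ∀ x, ‖c x‖ = 1) (t : ℝ) :
    lp (fun _ : ℝ => ℂ) 2 →ₗᵢ[ℂ] lp (fun _ : ℝ => ℂ) 2 where
  toFun f := ⟨fun x => c x * f (x + t), by
    have h := (memℓp_gen_iff (p := 2) (by norm_num)).mp (lp.memℓp f)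
    refine (memℓp_gen_iff (p := 2) (by norm_num)).mpr ?_
    simpa [hc, Function.comp_def] using h.comp_injective (add_left_injective t)⟩
  map_add' f g := by ext x; simp [mul_add]; rfl
  map_smul' r f := by ext x; simp [mul_left_comm]
  norm_map' f := by
    have h2 : 0 < (2 : ENNReal).toReal := by norm_num
    simp only [LinearMap.coe_mk, AddHom.coe_mk]
    rw [lp.norm_eq_tsum_rpow h2, lp.norm_eq_tsum_rpow h2]
    congr 1
    simpa [hc] using (Equiv.addRight t).tsum_eq fun x => ‖f x‖ ^ (2 : ENNReal).toReal

theorem weightedShift_apply (c : ℝ → ℂ) (hc : ∀ x, ‖c x‖ = 1) (t : ℝ)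
    (f : lp (fun _ : ℝ => ℂ) 2) (x : ℝ) : weightedShift c hc t f x = c x * f (x + t) := rfl

theorem weightedShift_surjective (c : ℝ → ℂ) (hc : ∀ x, ‖c x‖ = 1) (t : ℝ) :
    Function.Surjective (weightedShift c hc t) := by
  intro g
  refine ⟨weightedShift (fun x => (c (x - t))⁻¹) (fun x => by simp [hc]) (-t) g, ?_⟩
  ext x
  have : c x ≠ 0 := fun h => by simpa [h] using hc x
  simp [weightedShift_apply, this]

theorem weightedShift_mem_unitary (c : ℝ → ℂ) (hc : ∀ x, ‖c x‖ = 1) (t : ℝ) :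
    (weightedShift c hc t).toContinuousLinearMap ∈
      unitary (lp (fun _ : ℝ => ℂ) 2 →L[ℂ] lp (fun _ : ℝ => ℂ) 2) :=
  (Unitary.linearIsometryEquiv.symm (LinearIsometryEquiv.ofSurjective (weightedShift c hc t)
    (weightedShift_surjective c hc t))).2

/-- The position representation: `(U_a f)(x) = e^{iax} f(x)` on `ℓ²(ℝ)`. -/
noncomputable def posU (a : ℝ) : lp (fun _ : ℝ => ℂ) 2 →L[ℂ] lp (fun _ : ℝ => ℂ) 2 :=
  (weightedShift (fun x => Complex.exp (((a * x : ℝ) : ℂ) * Complex.I))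
    (fun _ => Complex.norm_exp_ofReal_mul_I _) 0).toContinuousLinearMap

/-- The position representation: `(V_b f)(x) = f(x + b)` on `ℓ²(ℝ)`. -/
noncomputable def posV (b : ℝ) : lp (fun _ : ℝ => ℂ) 2 →L[ℂ] lp (fun _ : ℝ => ℂ) 2 :=
  (weightedShift (fun _ => 1) (fun _ => norm_one) b).toContinuousLinearMap

/-- The C*-algebra of operators on `ℓ²(ℝ)` generated by the position representation. -/
noncomputable def posAlgebra :
    StarSubalgebra ℂ (lp (fun _ : ℝ => ℂ) 2 →L[ℂ] lp (fun _ : ℝ => ℂ) 2) :=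
  (StarAlgebra.adjoin ℂ (Set.range posU ∪ Set.range posV)).topologicalClosure

instance : IsClosed (posAlgebra : Set (lp (fun _ : ℝ => ℂ) 2 →L[ℂ] lp (fun _ : ℝ => ℂ) 2)) :=
  StarSubalgebra.isClosed_topologicalClosure _

theorem posU_mem (a : ℝ) : posU a ∈ posAlgebra :=
  StarSubalgebra.le_topologicalClosure _
    (StarAlgebra.subset_adjoin ℂ _ (Or.inl (Set.mem_range_self a)))

theorem posV_mem (b : ℝ) : posV b ∈ posAlgebra :=
  StarSubalgebra.le_topologicalClosure _
    (StarAlgebra.subset_adjoin ℂ _ (Or.inr (Set.mem_range_self b)))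

theorem posU_apply (a : ℝ) (f : lp (fun _ : ℝ => ℂ) 2) (x : ℝ) :
    posU a f x = Complex.exp (((a * x : ℝ) : ℂ) * Complex.I) * f x := by
  have h := weightedShift_apply (fun x => Complex.exp (((a * x : ℝ) : ℂ) * Complex.I))
    (fun _ => Complex.norm_exp_ofReal_mul_I _) 0 f x
  rw [add_zero] at h
  exact h

theorem posV_apply (b : ℝ) (f : lp (fun _ : ℝ => ℂ) 2) (x : ℝ) :
    posV b f x = f (x + b) := (one_mul (f (x + b)))

/-- The C*-algebra generated by the position representation is a Weyl algebra. -/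
theorem isWeylAlgebra_posAlgebra :
    IsWeylAlgebra (A := posAlgebra) (fun a => ⟨posU a, posU_mem a⟩)
      (fun b => ⟨posV b, posV_mem b⟩) where
  nontrivial := by
    refine ⟨⟨0, 1, fun h => ?_⟩⟩
    have h1 : (0 : lp (fun _ : ℝ => ℂ) 2 →L[ℂ] lp (fun _ : ℝ => ℂ) 2) = 1 :=
      congrArg Subtype.val h
    have h2 : (0 : lp (fun _ : ℝ => ℂ) 2) = lp.single 2 (0 : ℝ) (1 : ℂ) :=
      congrArg (fun T : lp (fun _ : ℝ => ℂ) 2 →L[ℂ] lp (fun _ : ℝ => ℂ) 2 =>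
        T (lp.single 2 (0 : ℝ) (1 : ℂ))) h1
    have h3 := congrArg (fun f : lp (fun _ : ℝ => ℂ) 2 => f 0) h2
    simp at h3
  unitary_U a := by
    have h := weightedShift_mem_unitary (fun x => Complex.exp (((a * x : ℝ) : ℂ) * Complex.I))
      (fun _ => Complex.norm_exp_ofReal_mul_I _) 0
    exact Unitary.mem_iff.mpr ⟨Subtype.ext (Unitary.mem_iff.mp h).1,
      Subtype.ext (Unitary.mem_iff.mp h).2⟩
  unitary_V b := by
    have h := weightedShift_mem_unitary (fun _ => 1) (fun _ => norm_one) b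
    exact Unitary.mem_iff.mpr ⟨Subtype.ext (Unitary.mem_iff.mp h).1,
      Subtype.ext (Unitary.mem_iff.mp h).2⟩
  add_U a b := by
    refine Subtype.ext (ContinuousLinearMap.ext fun f => lp.ext (funext fun x => ?_))
    change posU (a + b) f x = posU a (posU b f) x
    rw [posU_apply, posU_apply, posU_apply, ← mul_assoc, ← Complex.exp_add]
    congr 2
    push_cast
    ring
  add_V a b := by
    refine Subtype.ext (ContinuousLinearMap.ext fun f => lp.ext (funext fun x => ?_))
    change posV (a + b) f x = posV a (posV b f) x
    rw [posV_apply, posV_apply, posV_apply, add_assoc]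
  weyl a b := by
    refine Subtype.ext (ContinuousLinearMap.ext fun f => lp.ext (funext fun x => ?_))
    change posU a (posV b f) x =
      Complex.exp (-((a * b : ℝ) : ℂ) * Complex.I) * posV b (posU a f) x
    rw [posU_apply, posV_apply, posV_apply, posU_apply, ← mul_assoc, ← Complex.exp_add]
    congr 2
    push_cast
    ring
  generates := by
    set T := StarAlgebra.adjoin ℂ
      (Set.range (fun a => (⟨posU a, posU_mem a⟩ : posAlgebra)) ∪
        Set.range (fun b => (⟨posV b, posV_mem b⟩ : posAlgebra))) with hT
    have hc : IsClosedMap posAlgebra.subtype :=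
      (IsClosed.isClosedEmbedding_subtypeVal
        (StarSubalgebra.isClosed_topologicalClosure _)).isClosedMap
    have h1 : T.map posAlgebra.subtype =
        StarAlgebra.adjoin ℂ (Set.range posU ∪ Set.range posV) := by
      rw [hT, StarAlgHom.map_adjoin, Set.image_union, ← Set.range_comp, ← Set.range_comp]
      rfl
    have h2 : T.topologicalClosure.map posAlgebra.subtype = posAlgebra := by
      refine le_antisymm ?_ ?_
      · rintro _ ⟨y, _, rfl⟩
        exact y.2
      · have := StarSubalgebra.topologicalClosure_map_le T posAlgebra.subtype hc
        rwa [h1] at this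
    refine eq_top_iff.mpr fun x _ => ?_
    have hx : (x : lp (fun _ : ℝ => ℂ) 2 →L[ℂ] lp (fun _ : ℝ => ℂ) 2) ∈
        T.topologicalClosure.map posAlgebra.subtype := by
      rw [h2]
      exact x.2
    obtain ⟨y, hy, hyx⟩ := hx
    exact (Subtype.ext hyx : y = x) ▸ hy

/-!
An atom of `E^Q` at a point of `ℝ` produces a joint eigenvector `φ` of all the `U_a`. By the Weyl
relation the vectors `V_b φ` are again joint eigenvectors of the `U_a`, with pairwise different
eigenvalue characters, so they are mutually orthogonal; by irreducibility they span a dense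
subspace. For each `ψ = V_c φ` the orthogonality says that `⟪ψ, V_b ψ⟫ = 0` for `b ≠ 0`, that is,
the measure `μ` of `ψ` with respect to `E^P` has the Fourier coefficients of a multiple of the Haar
measure of `bℝ`. Such a measure does not charge `ℝ` (`vectorMeasure_range_toBohr_eq_zero`): the
function `|∑_{j < N} u_{jε}|²` has integral `N ‖ψ‖²`, while for small `ε` it is at least `N² / 4`
on a given bounded interval, which therefore has measure at most `4 ‖ψ‖² / N`. Hence `E^P(ℝ)`
annihilates a dense subspace. This argument is `proj_range_toBohr_eq_zero`, in terms of two families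
of unitaries that commute up to scalars, so that it applies with the roles of `U` and `V` exchanged.

Only Markov's inequality for continuous functions enters, so no regularity of the Borel
measures on the non-metrizable space `bℝ` is needed.
-/

open scoped ComplexConjugate

/-! ### The exponentials on the Bohr compactification -/

instance completeSpace_almostPeriodic : CompleteSpace almostPeriodic :=
  (StarSubalgebra.isClosed_topologicalClosure _).completeSpace_coe

theorem bohrChar_add (a b : ℝ) (χ : BohrR) :
    bohrChar (a + b) χ = bohrChar a χ * bohrChar b χ := by
  have h : apExp (a + b) = apExp a * apExp b := by
    refine Subtype.ext (BoundedContinuousFunction.ext fun x => ?_)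
    change Complex.exp ((((a + b) * x : ℝ) : ℂ) * Complex.I) =
      Complex.exp (((a * x : ℝ) : ℂ) * Complex.I) * Complex.exp (((b * x : ℝ) : ℂ) * Complex.I)
    rw [← Complex.exp_add]
    congr 1
    push_cast
    ring
  rw [bohrChar, h, map_mul]
  rfl

theorem bohrChar_zero (χ : BohrR) : bohrChar 0 χ = 1 := by
  have h : apExp 0 = 1 := by
    refine Subtype.ext (BoundedContinuousFunction.ext fun x => ?_)
    change Complex.exp (((0 * x : ℝ) : ℂ) * Complex.I) = 1
    simp
  rw [bohrChar, h, map_one]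

theorem norm_bohrChar_le_one (a : ℝ) (χ : BohrR) : ‖bohrChar a χ‖ ≤ 1 := by
  have h : ‖apExp a‖ ≤ 1 :=
    BoundedContinuousFunction.norm_ofNormedAddCommGroup_le _ zero_le_one fun x =>
      (Complex.norm_exp_ofReal_mul_I _).le
  exact (AlgHom.norm_apply_le_self χ (apExp a)).trans h

theorem norm_bohrChar (a : ℝ) (χ : BohrR) : ‖bohrChar a χ‖ = 1 := by
  refine le_antisymm (norm_bohrChar_le_one a χ) ?_
  have h : ‖bohrChar a χ‖ * ‖bohrChar (-a) χ‖ = 1 := by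
    rw [← norm_mul, ← bohrChar_add, add_neg_cancel, bohrChar_zero, norm_one]
  nlinarith [norm_bohrChar_le_one (-a) χ, norm_nonneg (bohrChar a χ)]

theorem conj_bohrChar (a : ℝ) (χ : BohrR) : conj (bohrChar a χ) = bohrChar (-a) χ := by
  rw [← Complex.inv_eq_conj (norm_bohrChar a χ), inv_eq_iff_eq_inv]
  refine eq_inv_of_mul_eq_one_left ?_
  rw [← bohrChar_add, add_neg_cancel, bohrChar_zero]

theorem continuous_bohrChar (a : ℝ) : Continuous (bohrChar a) :=
  (WeakDual.eval_continuous (apExp a)).comp continuous_subtype_val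

theorem integrable_bohrChar (a : ℝ) (μ : Measure BohrR) [IsFiniteMeasure μ] :
    Integrable (bohrChar a) μ :=
  .of_bound (continuous_bohrChar a).aestronglyMeasurable 1
    (.of_forall fun χ => norm_bohrChar_le_one a χ)

/-! ### Measures with the Fourier coefficients of Haar measure -/

theorem norm_sum_bohrChar_sq (N : ℕ) (ε : ℝ) (χ : BohrR) :
    ((‖∑ j ∈ Finset.range N, bohrChar (j * ε) χ‖ ^ 2 : ℝ) : ℂ) =
      ∑ j ∈ Finset.range N, ∑ k ∈ Finset.range N, bohrChar ((j - k) * ε) χ := by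
  push_cast
  rw [← Complex.mul_conj', map_sum, Finset.sum_mul_sum]
  refine Finset.sum_congr rfl fun j _ => Finset.sum_congr rfl fun k _ => ?_
  rw [conj_bohrChar, ← bohrChar_add]
  congr 1
  ring

/-- The trigonometric polynomial `|∑_{j < N} u_{jε}|²` has mean `N`. -/
theorem integral_norm_sum_bohrChar_sq {μ : Measure BohrR} [IsFiniteMeasure μ]
    (hμ : ∀ b : ℝ, b ≠ 0 → ∫ χ, bohrChar b χ ∂μ = 0) (N : ℕ) {ε : ℝ} (hε : ε ≠ 0) :
    ∫ χ, ‖∑ j ∈ Finset.range N, bohrChar (j * ε) χ‖ ^ 2 ∂μ = N * μ.real Set.univ := by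
  apply Complex.ofReal_injective
  rw [← integral_complex_ofReal]
  simp_rw [norm_sum_bohrChar_sq]
  rw [integral_finsetSum _ fun j _ => integrable_finsetSum _ fun k _ => integrable_bohrChar _ μ]
  have h : ∀ j ∈ Finset.range N,
      ∫ χ, ∑ k ∈ Finset.range N, bohrChar (((j : ℝ) - k) * ε) χ ∂μ = μ.real Set.univ := by
    intro j hj
    rw [integral_finsetSum _ fun k _ => integrable_bohrChar _ μ, Finset.sum_eq_single_of_mem j hj]
    · simp [bohrChar_zero]
    · intro k _ hkj
      exact hμ _ (mul_ne_zero (sub_ne_zero.mpr (Nat.cast_injective.ne hkj.symm)) hε)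
  rw [Finset.sum_congr rfl h]
  simp

/-- For frequencies that are small compared with `1 / N`, the exponentials `u_{jε}`, `j < N`, are
all close to `1` on a bounded interval, and do not cancel in the sum. -/
theorem le_norm_sum_bohrChar_toBohr {N : ℕ} {ε x : ℝ} (h : N * |ε * x| ≤ 1 / 2) :
    (N : ℝ) / 2 ≤ ‖∑ j ∈ Finset.range N, bohrChar (j * ε) (toBohr x)‖ := by
  have h1 : ∀ j ∈ Finset.range N, ‖bohrChar (j * ε) (toBohr x) - 1‖ ≤ 1 / 2 := by
    intro j hj
    rw [bohrChar_toBohr, mul_comm _ Complex.I]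
    refine (Real.norm_exp_I_mul_ofReal_sub_one_le).trans ?_
    rw [Real.norm_eq_abs, mul_assoc, abs_mul, Nat.abs_cast]
    refine le_trans ?_ h
    gcongr
    exact (Finset.mem_range.mp hj).le
  have h2 := norm_sum_le_of_le _ h1
  rw [Finset.sum_sub_distrib] at h2
  simp only [Finset.sum_const, Finset.card_range, nsmul_eq_mul, mul_one] at h2
  have h3 := norm_sub_norm_le (N : ℂ) (∑ j ∈ Finset.range N, bohrChar (j * ε) (toBohr x))
  rw [norm_sub_rev, Complex.norm_natCast] at h3
  linarith

theorem measure_image_toBohr_Icc_eq_zero {μ : Measure BohrR} [IsFiniteMeasure μ]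
    (hμ : ∀ b : ℝ, b ≠ 0 → ∫ χ, bohrChar b χ ∂μ = 0) (n : ℕ) :
    μ (toBohr '' Set.Icc (-(n : ℝ)) n) = 0 := by
  set K := toBohr '' Set.Icc (-(n : ℝ)) n
  have key : ∀ N : ℕ, (N : ℝ) * μ.real K ≤ 4 * μ.real Set.univ := by
    intro N
    rcases N.eq_zero_or_pos with rfl | hN
    · simp only [Nat.cast_zero, zero_mul]
      positivity
    have hN' : (0 : ℝ) < N := Nat.cast_pos.mpr hN
    -- `ε` is such that `N ε |x| ≤ 1 / 2` for all `x ∈ [-n, n]`.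
    set ε : ℝ := 1 / (2 * N * (n + 1)) with hε
    have hε0 : 0 < ε := by positivity
    set g : BohrR → ℝ := fun χ => ‖∑ j ∈ Finset.range N, bohrChar (j * ε) χ‖ ^ 2
    have hgc : Continuous g :=
      (continuous_finsetSum _ fun j _ => continuous_bohrChar _).norm.pow 2
    have hgi : Integrable g μ := by
      refine .of_bound hgc.aestronglyMeasurable ((N : ℝ) ^ 2) (.of_forall fun χ => ?_)
      rw [Real.norm_of_nonneg (by positivity)]
      refine pow_le_pow_left₀ (norm_nonneg _) ?_ 2
      refine (norm_sum_le_of_le _ fun j _ => norm_bohrChar_le_one _ χ).trans ?_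
      simp
    have hK : K ⊆ {χ | ((N : ℝ) / 2) ^ 2 ≤ g χ} := by
      rintro _ ⟨x, hx, rfl⟩
      refine pow_le_pow_left₀ (by positivity) (le_norm_sum_bohrChar_toBohr ?_) 2
      have hx' : |x| ≤ n + 1 := (abs_le.mpr hx).trans (by linarith)
      rw [abs_mul, abs_of_pos hε0]
      calc (N : ℝ) * (ε * |x|) ≤ N * (ε * (n + 1)) := by gcongr
        _ = 1 / 2 := by rw [hε]; field_simp
    have h1 := mul_meas_ge_le_integral_of_nonneg (.of_forall fun χ => by positivity) hgi
      (((N : ℝ) / 2) ^ 2)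
    rw [integral_norm_sum_bohrChar_sq hμ N hε0.ne'] at h1
    have h2 : μ.real K ≤ μ.real {χ | ((N : ℝ) / 2) ^ 2 ≤ g χ} := measureReal_mono hK
    have h3 : (N : ℝ) * (N * μ.real K) ≤ N * (4 * μ.real Set.univ) := by
      nlinarith [mul_le_mul_of_nonneg_left h2 (sq_nonneg (N : ℝ))]
    exact le_of_mul_le_mul_left h3 hN'
  rw [← measureReal_eq_zero_iff]
  by_contra hne
  have hpos : 0 < μ.real K := lt_of_le_of_ne measureReal_nonneg (Ne.symm hne)
  obtain ⟨N, hN⟩ := exists_nat_gt (4 * μ.real Set.univ / μ.real K)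
  rw [div_lt_iff₀ hpos] at hN
  exact (key N).not_gt hN

/-- A finite measure on `bℝ` whose nonzero Fourier coefficients vanish does not charge `ℝ`. -/
theorem measure_range_toBohr_eq_zero {μ : Measure BohrR} [IsFiniteMeasure μ]
    (hμ : ∀ b : ℝ, b ≠ 0 → ∫ χ, bohrChar b χ ∂μ = 0) : μ (Set.range toBohr) = 0 := by
  refine measure_mono_null ?_ (measure_iUnion_null (measure_image_toBohr_Icc_eq_zero hμ))
  rintro _ ⟨x, rfl⟩
  obtain ⟨n, hn⟩ := exists_nat_ge |x|
  exact Set.mem_iUnion.mpr ⟨n, x, abs_le.mp hn, rfl⟩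

/-! ### The vector measures of a projection-valued measure -/

namespace ProjectionValuedMeasure

variable {X : Type*} [MeasurableSpace X]
  {H : Type*} [NormedAddCommGroup H] [InnerProductSpace ℂ H] [CompleteSpace H]

theorem inner_proj_self (E : ProjectionValuedMeasure X H) (φ : H) {S : Set X}
    (hS : MeasurableSet S) : (⟪φ, E.proj S φ⟫_ℂ).re = ‖E.proj S φ‖ ^ 2 := by
  have h := E.isStarProjection S hS
  have h1 : E.proj S (E.proj S φ) = E.proj S φ :=
    congrArg (fun T : H →L[ℂ] H => T φ) h.isIdempotentElem.eq
  have h2 : ContinuousLinearMap.adjoint (E.proj S) = E.proj S := h.isSelfAdjoint.star_eq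
  rw [← h1, ← ContinuousLinearMap.adjoint_inner_left, h2, h1]
  exact inner_self_eq_norm_sq (𝕜 := ℂ) _

theorem vectorMeasure_eq_norm_sq (E : ProjectionValuedMeasure X H) (φ : H) {S : Set X}
    (hS : MeasurableSet S) : E.vectorMeasure φ S = ENNReal.ofReal (‖E.proj S φ‖ ^ 2) := by
  rw [E.vectorMeasure_apply φ hS, E.inner_proj_self φ hS]

theorem vectorMeasure_univ (E : ProjectionValuedMeasure X H) (φ : H) :
    E.vectorMeasure φ Set.univ = ENNReal.ofReal (‖φ‖ ^ 2) := by
  rw [E.vectorMeasure_eq_norm_sq φ .univ, E.proj_univ]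
  rfl

instance isFiniteMeasure_vectorMeasure (E : ProjectionValuedMeasure X H) (φ : H) :
    IsFiniteMeasure (E.vectorMeasure φ) :=
  ⟨by rw [vectorMeasure_univ]; exact ENNReal.ofReal_lt_top⟩

theorem proj_apply_eq_zero_of_vectorMeasure_eq_zero (E : ProjectionValuedMeasure X H) {φ : H}
    {S : Set X} (hS : MeasurableSet S) (h : E.vectorMeasure φ S = 0) : E.proj S φ = 0 := by
  rw [E.vectorMeasure_eq_norm_sq φ hS, ENNReal.ofReal_eq_zero] at h
  have := sq_nonneg ‖E.proj S φ‖
  exact norm_eq_zero.mp (pow_eq_zero_iff two_ne_zero |>.mp (le_antisymm h this))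

/-- The measure of a vector in the range of `E(S)` is concentrated on `S`. -/
theorem ae_mem_of_proj_apply_eq_self (E : ProjectionValuedMeasure X H) {φ : H}
    {S : Set X} (hS : MeasurableSet S) (h : E.proj S φ = φ) :
    ∀ᵐ x ∂E.vectorMeasure φ, x ∈ S := by
  refine (ae_iff_measure_eq (p := (· ∈ S)) hS.nullMeasurableSet).mpr ?_
  change E.vectorMeasure φ S = _
  rw [E.vectorMeasure_eq_norm_sq φ hS, h,
    vectorMeasure_univ]

end ProjectionValuedMeasure

/-! ### Orbits of a joint eigenvector -/

section Orbit

variable {H : Type*} [NormedAddCommGroup H] [InnerProductSpace ℂ H] [CompleteSpace H]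

theorem inner_unitary_apply {T : H →L[ℂ] H} (hT : T ∈ unitary (H →L[ℂ] H)) (φ ψ : H) :
    ⟪T φ, T ψ⟫_ℂ = ⟪φ, ψ⟫_ℂ := by
  rw [← ContinuousLinearMap.adjoint_inner_right]
  congr 1
  exact congrArg (fun S : H →L[ℂ] H => S ψ) (Unitary.mem_iff.mp hT).1

/-- A vector in the range of the projection of a point of `ℝ ⊆ bℝ` is a joint eigenvector. -/
theorem IsSpectralMeasureOf.apply_eq_smul {E : ProjectionValuedMeasure BohrR H}
    {W : ℝ → H →L[ℂ] H} (hE : IsSpectralMeasureOf E W) (hW : ∀ a, W a ∈ unitary (H →L[ℂ] H))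
    {x : BohrR} {φ : H} (hφ : E.proj {x} φ = φ) (a : ℝ) :
    W a φ = bohrChar a x • φ := by
  have h1 : ⟪φ, W a φ⟫_ℂ = bohrChar a x * ((‖φ‖ ^ 2 : ℝ) : ℂ) := by
    rw [hE a φ]
    have h : bohrChar a =ᵐ[E.vectorMeasure φ] fun _ => bohrChar a x := by
      filter_upwards [E.ae_mem_of_proj_apply_eq_self (measurableSet_singleton x) hφ] with y hy
      rw [Set.mem_singleton_iff.mp hy]
    rw [integral_congr_ae h, integral_const, Measure.real, E.vectorMeasure_univ,
      ENNReal.toReal_ofReal (by positivity), Complex.real_smul, mul_comm]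
  have h2 : ‖W a φ‖ ^ 2 = ‖φ‖ ^ 2 := by
    rw [← inner_self_eq_norm_sq (𝕜 := ℂ), inner_unitary_apply (hW a), inner_self_eq_norm_sq]
  have h3 : (⟪W a φ, bohrChar a x • φ⟫_ℂ).re = ‖φ‖ ^ 2 := by
    rw [← inner_conj_symm, inner_smul_left, h1, ← mul_assoc, Complex.conj_mul', norm_bohrChar]
    simp [-Complex.ofReal_pow]
  have h4 := norm_sub_sq (𝕜 := ℂ) (W a φ) (bohrChar a x • φ)
  rw [RCLike.re_to_complex, h3, h2, norm_smul, norm_bohrChar, one_mul] at h4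
  have h5 : ‖W a φ - bohrChar a x • φ‖ ^ 2 = 0 := by linarith
  exact sub_eq_zero.mp (norm_eq_zero.mp (pow_eq_zero_iff two_ne_zero |>.mp h5))

/-- Two vectors which a unitary multiplies by different scalars, the first of modulus one, are
orthogonal. The second scalar is written relative to the first. -/
theorem inner_eq_zero_of_unitary_eigenvectors {T : H →L[ℂ] H} (hT : T ∈ unitary (H →L[ℂ] H))
    {z w : ℂ} (hz : ‖z‖ = 1) (hw : w ≠ 1) {φ ψ : H} (hφ : T φ = z • φ)
    (hψ : T ψ = w • z • ψ) : ⟪φ, ψ⟫_ℂ = 0 := by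
  have h := inner_unitary_apply hT φ ψ
  rw [hφ, hψ, inner_smul_left, inner_smul_right, inner_smul_right] at h
  have hz' : conj z * z = 1 := by rw [Complex.conj_mul', hz]; simp
  have h' : (w - 1) * ⟪φ, ψ⟫_ℂ = 0 := by linear_combination h - w * ⟪φ, ψ⟫_ℂ * hz'
  exact (mul_eq_zero.mp h').resolve_left (sub_ne_zero.mpr hw)

/-- If `U` and `V` are families of unitaries that act irreducibly and commute up to scalars
`c a b`, where `c · b` is not identically `1` for `b ≠ 0`, and the spectral measure of `U` has an
atom in `bℝ`, then the spectral measure of the one-parameter group `V` vanishes on `ℝ`. -/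
theorem proj_range_toBohr_eq_zero {U V : ℝ → H →L[ℂ] H}
    (hU : ∀ a, U a ∈ unitary (H →L[ℂ] H)) (hV : ∀ b, V b ∈ unitary (H →L[ℂ] H))
    (hVadd : ∀ a b, V (a + b) = V a * V b)
    {c : ℝ → ℝ → ℂ} (hc : ∀ b ≠ 0, ∃ a, c a b ≠ 1)
    (hUV : ∀ a b, U a * V b = c a b • (V b * U a))
    (hirr : ∀ K : Submodule ℂ H, IsClosed (K : Set H) →
      (∀ a, ∀ φ ∈ K, U a φ ∈ K) → (∀ b, ∀ φ ∈ K, V b φ ∈ K) → K = ⊥ ∨ K = ⊤)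
    {E F : ProjectionValuedMeasure BohrR H}
    (hE : IsSpectralMeasureOf E U) (hF : IsSpectralMeasureOf F V)
    {x : BohrR} (hx : E.proj {x} ≠ 0) : F.proj (Set.range toBohr) = 0 := by
  obtain ⟨φ₀, hφ₀⟩ : ∃ φ₀, E.proj {x} φ₀ ≠ 0 := by
    by_contra! h
    exact hx (ContinuousLinearMap.ext h)
  set φ := E.proj {x} φ₀
  have hφ : E.proj {x} φ = φ := congrArg (fun T : H →L[ℂ] H => T φ₀)
    (E.isStarProjection {x} (measurableSet_singleton x)).isIdempotentElem.eq
  have hUφ : ∀ a, U a φ = bohrChar a x • φ := hE.apply_eq_smul hU hφ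
  have hUVφ : ∀ a b, U a (V b φ) = c a b • bohrChar a x • V b φ := by
    intro a b
    have h := congrArg (fun T : H →L[ℂ] H => T φ) (hUV a b)
    change U a (V b φ) = c a b • V b (U a φ) at h
    rw [h, hUφ, map_smul]
  have hV0 : V 0 φ = φ := by
    have h : V 0 (V 0 φ) = V 0 φ :=
      (congrArg (fun T : H →L[ℂ] H => T φ) (hVadd 0 0)).symm.trans (by rw [add_zero])
    rw [← sub_eq_zero, ← norm_eq_zero, ← sq_eq_zero_iff, ← inner_self_eq_norm_sq (𝕜 := ℂ),
      ← inner_unitary_apply (hV 0), map_sub, h, sub_self, inner_zero_left, map_zero]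
  -- The vectors `V_b φ` are annihilated by `F(ℝ)`.
  have hzero : ∀ b, F.proj (Set.range toBohr) (V b φ) = 0 := by
    intro b
    refine F.proj_apply_eq_zero_of_vectorMeasure_eq_zero measurableSet_range_toBohr
      (measure_range_toBohr_eq_zero fun d hd => ?_)
    rw [← hF]
    obtain ⟨a, ha⟩ := hc d hd
    have h : V d (V b φ) = V b (V d φ) := by
      change (V d * V b) φ = (V b * V d) φ
      rw [← hVadd, ← hVadd, add_comm]
    rw [h, inner_unitary_apply (hV b)]
    exact inner_eq_zero_of_unitary_eigenvectors (hU a) (norm_bohrChar a x) ha (hUφ a) (hUVφ a d)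
  -- Their closed span is invariant, hence everything.
  set K₀ := Submodule.span ℂ (Set.range fun b => V b φ)
  have hinv : ∀ T : H →L[ℂ] H, (∀ b, T (V b φ) ∈ K₀) →
      ∀ ψ ∈ K₀.topologicalClosure, T ψ ∈ K₀.topologicalClosure := by
    intro T hT ψ hψ
    have h : K₀ ≤ K₀.comap (T : H →ₗ[ℂ] H) :=
      Submodule.span_le.mpr (by rintro _ ⟨b, rfl⟩; exact hT b)
    exact map_mem_closure T.continuous hψ fun y hy => h hy
  have hmem : ∀ b, V b φ ∈ K₀ := fun b => Submodule.subset_span ⟨b, rfl⟩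
  have htop : K₀.topologicalClosure = ⊤ := by
    refine (hirr _ K₀.isClosed_topologicalClosure (fun a => hinv _ fun b => ?_)
      (fun d => hinv _ fun b => ?_)).resolve_left fun hbot => hφ₀ ?_
    · rw [hUVφ]
      exact K₀.smul_mem _ (K₀.smul_mem _ (hmem b))
    · have h : V d (V b φ) = V (d + b) φ := by rw [hVadd]; rfl
      rw [h]
      exact hmem _
    · have h : V 0 φ ∈ K₀.topologicalClosure := K₀.le_topologicalClosure (hmem 0)
      rwa [hbot, hV0, Submodule.mem_bot] at h
  have hker : K₀.topologicalClosure ≤ (F.proj (Set.range toBohr) : H →ₗ[ℂ] H).ker := by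
    refine K₀.topologicalClosure_minimal (Submodule.span_le.mpr ?_)
      (F.proj (Set.range toBohr)).isClosed_ker
    rintro _ ⟨b, rfl⟩
    exact hzero b
  exact ContinuousLinearMap.ext fun ψ => hker (htop ▸ Submodule.mem_top)

end Orbit

/-! ### Representations of the Weyl algebra -/

theorem star_eq_neg_of_unitary_of_add {R : Type*} [Monoid R] [StarMul R] {W : ℝ → R}
    (hW : ∀ a, W a ∈ unitary R) (hadd : ∀ a b, W (a + b) = W a * W b) (a : ℝ) :
    star (W a) = W (-a) := by
  have h0 : W 0 = 1 := by
    have h : W 0 = W 0 * W 0 := by rw [← hadd, add_zero]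
    calc W 0 = star (W 0) * W 0 * W 0 := by rw [(Unitary.mem_iff.mp (hW 0)).1, one_mul]
      _ = star (W 0) * W 0 := by rw [mul_assoc, ← h]
      _ = 1 := (Unitary.mem_iff.mp (hW 0)).1
  calc star (W a) = star (W a) * (W a * W (-a)) := by rw [← hadd, add_neg_cancel, h0, mul_one]
    _ = W (-a) := by rw [← mul_assoc, (Unitary.mem_iff.mp (hW a)).1, one_mul]

/-- A closed subspace which is invariant under the generators is invariant under the whole Weyl
algebra. -/
theorem IsWeylAlgebra.apply_mem {A : Type*} [CStarAlgebra A] {U V : ℝ → A}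
    (hA : IsWeylAlgebra U V) {H : Type*} [NormedAddCommGroup H] [InnerProductSpace ℂ H]
    [CompleteSpace H] (π : A →⋆ₐ[ℂ] (H →L[ℂ] H)) {K : Submodule ℂ H} (hK : IsClosed (K : Set H))
    (hU : ∀ a, ∀ φ ∈ K, π (U a) φ ∈ K) (hV : ∀ b, ∀ φ ∈ K, π (V b) φ ∈ K)
    (x : A) {φ : H} (hφ : φ ∈ K) : π x φ ∈ K := by
  have hadj : ∀ y ∈ StarAlgebra.adjoin ℂ (Set.range U ∪ Set.range V),
      (∀ ψ ∈ K, π y ψ ∈ K) ∧ ∀ ψ ∈ K, π (star y) ψ ∈ K := by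
    intro y hy
    induction hy using StarAlgebra.adjoin_induction with
    | mem y hy =>
      rcases hy with ⟨a, rfl⟩ | ⟨b, rfl⟩
      · rw [star_eq_neg_of_unitary_of_add hA.unitary_U hA.add_U]
        exact ⟨hU a, hU (-a)⟩
      · rw [star_eq_neg_of_unitary_of_add hA.unitary_V hA.add_V]
        exact ⟨hV b, hV (-b)⟩
    | algebraMap r =>
      rw [← algebraMap_star_comm, AlgHomClass.commutes, AlgHomClass.commutes]
      exact ⟨fun ψ hψ => K.smul_mem r hψ, fun ψ hψ => K.smul_mem (star r) hψ⟩
    | add y z _ _ hy hz =>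
      rw [star_add, map_add, map_add]
      exact ⟨fun ψ hψ => K.add_mem (hy.1 ψ hψ) (hz.1 ψ hψ),
        fun ψ hψ => K.add_mem (hy.2 ψ hψ) (hz.2 ψ hψ)⟩
    | mul y z _ _ hy hz =>
      rw [star_mul, map_mul, map_mul]
      exact ⟨fun ψ hψ => hy.1 _ (hz.1 ψ hψ), fun ψ hψ => hz.2 _ (hy.2 ψ hψ)⟩
    | star y _ hy =>
      rw [star_star]
      exact hy.symm
  have hx : x ∈ (StarAlgebra.adjoin ℂ (Set.range U ∪ Set.range V)).topologicalClosure := by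
    rw [hA.generates]
    exact StarSubalgebra.mem_top
  have hπ : Continuous π := AddMonoidHomClass.continuous_of_bound π 1 fun y => by
    simpa using NonUnitalStarAlgHom.norm_apply_le π y
  have hcont : Continuous fun y : A => π y φ := hπ.clm_apply continuous_const
  have := map_mem_closure (t := (K : Set H)) hcont hx fun y hy => (hadj y hy).1 φ hφ
  rwa [hK.closure_eq] at this

theorem exists_exp_ofReal_mul_I_ne_one {b : ℝ} (hb : b ≠ 0) :
    ∃ a : ℝ, Complex.exp (((a * b : ℝ) : ℂ) * Complex.I) ≠ 1 := by
  refine ⟨Real.pi / b, ?_⟩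
  rw [div_mul_cancel₀ _ hb, Complex.exp_pi_mul_I]
  norm_num

theorem mainTheorem1 {A : Type*} [CStarAlgebra A] (U V : ℝ → A) (hA : IsWeylAlgebra U V)
    {H : Type*} [NormedAddCommGroup H] [InnerProductSpace ℂ H] [CompleteSpace H]
    (π : A →⋆ₐ[ℂ] (H →L[ℂ] H)) (hπ : IsIrreducibleRep π)
    (EQ EP : ProjectionValuedMeasure BohrR H)
    (hQ : IsSpectralMeasureOf EQ (fun a => π (U a)))
    (hP : IsSpectralMeasureOf EP (fun b => π (V b))) :
    ((∃ x : ℝ, EQ.proj {toBohr x} ≠ 0) → EP.proj (Set.range toBohr) = 0) ∧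
    ((∃ x : ℝ, EP.proj {toBohr x} ≠ 0) → EQ.proj (Set.range toBohr) = 0) := by
  have hUu : ∀ a, π (U a) ∈ unitary (H →L[ℂ] H) := fun a => Unitary.map_mem π (hA.unitary_U a)
  have hVu : ∀ b, π (V b) ∈ unitary (H →L[ℂ] H) := fun b => Unitary.map_mem π (hA.unitary_V b)
  have hirr : ∀ K : Submodule ℂ H, IsClosed (K : Set H) →
      (∀ a, ∀ φ ∈ K, π (U a) φ ∈ K) → (∀ b, ∀ φ ∈ K, π (V b) φ ∈ K) → K = ⊥ ∨ K = ⊤ :=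
    fun K hK h1 h2 => hπ.2 K hK fun x φ hφ => hA.apply_mem π hK h1 h2 x hφ
  constructor
  · rintro ⟨x, hx⟩
    refine proj_range_toBohr_eq_zero hUu hVu (fun a b => by rw [hA.add_V, map_mul])
      (c := fun a b => Complex.exp (-((a * b : ℝ) : ℂ) * Complex.I)) (fun b hb => ?_)
      (fun a b => by rw [← map_mul, hA.weyl, map_smul, map_mul]) hirr hQ hP hx
    obtain ⟨a, ha⟩ := exists_exp_ofReal_mul_I_ne_one (neg_ne_zero.mpr hb)
    exact ⟨a, by simpa using ha⟩
  · rintro ⟨x, hx⟩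
    refine proj_range_toBohr_eq_zero hVu hUu (fun a b => by rw [hA.add_U, map_mul])
      (c := fun b a => Complex.exp (((b * a : ℝ) : ℂ) * Complex.I))
      (fun a ha => exists_exp_ofReal_mul_I_ne_one ha) (fun b a => ?_)
      (fun K hK h1 h2 => hirr K hK h2 h1) hP hQ hx
    rw [← map_mul, ← map_mul, hA.weyl, map_smul, smul_smul, ← Complex.exp_add, mul_comm b a,
      neg_mul, add_neg_cancel, Complex.exp_zero, one_smul]
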